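/- **Proposition.** Let $f\ge 1$ be an integer, let $C=\begin{pmatrix} f & f\\ f & f+1\end{pmatrix}$, and let $$P_C(x_1,x_2)=\sum_{d_1,d_2\ge 0}(-1)^{f(d_1+d_2)}(-q)^{f d_1^2+2f d_1d_2+(f+1)d_2^2}\,\frac{x_1^{d_1}x_2^{d_2}}{(q^2;q^2)_{d_1}(q^2;q^2)_{d_2}},\qquad (x;p)_n=\prod_{s=0}^{n-1}(1-xp^s),$$ be the associated quiver generating series, a formal power series in $x_1,x_2$ whose coefficients are rational functions of $q$. Put $\bar P_C(x)=P_C(-a^2x,x)$ and define the numbers $n_{i,j,k}$ by $$y(x,a,q)=\frac{\bar P_C(qx)}{\bar P_C(q^{-1}x)}=\sum_{k\ge 0}N_k(a,q)\,x^k=\sum_{k\ge 0}\ \sum_{i,j\in\mathbb Z}n_{i,j,k}\,a^iq^jx^k ,$$ where each $N_k(a,q)\in\mathbb Q(a,q)$ is expanded as a Laurent series in $q$ with coefficients in $\mathbb Q((a))$. A generalized Schröder path under the line $y=x/f$ is a lattice path with steps $(1,0)$, $(0,1)$ and $(1,1)$ that stays weakly below the line $y=x/f$. Then for all $i,j\in\mathbb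 Z$ and $k\ge 0$, the number $n_{i,j,k}$ is equal to the (finite) number of generalized Schröder paths under the line $y=x/f$ that start at $(0,0)$, end at $(fk,k)$, have exactly $\frac i2$ diagonal steps, and are such that the area of the region between the path and the line $y=x/f$ is equal to $\frac j2$. -/

import Mathlib

noncomputable section

/-! ### Quiver generating series -/

/-- The `q`-Pochhammer symbol `(x; p)_n = ∏_{j < n} (1 - x p ^ j)`. -/
def qPoch {K : Type*} [Field K] (x p : K) (n : ℕ) : K :=
  ∏ j ∈ Finset.range n, (1 - x * p ^ j)

/-- The quiver matrix `[[f, f], [f, f + 1]]`. -/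
def quiverMatrix (f : ℕ) : Matrix (Fin 2) (Fin 2) ℕ := !![f, f; f, f + 1]

/-- The quiver generating series (with the framing sign `(-1) ^ (f (d₁ + d₂))`)
`∑ (-1)^(f (d₁ + d₂)) (-q)^(∑ C_{s,t} d_s d_t) x₁^d₁ x₂^d₂ / ((q²; q²)_{d₁} (q²; q²)_{d₂})`
of the matrix `C = [[f, f], [f, f + 1]]`: a power series in two variables, given by its
coefficients. -/
def quiverSeries {K : Type*} [Field K] (q : K) (f : ℕ) : MvPowerSeries (Fin 2) K := fun d =>
  (-1) ^ (f * ∑ s, d s) * (-q) ^ (∑ s, ∑ t, quiverMatrix f s t * d s * d t) /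
    ∏ s, qPoch (q ^ 2) (q ^ 2) (d s)

/-- The substitution `x₁ ↦ -a² x`, `x₂ ↦ x`. -/
def specialization {K : Type*} [Field K] (a : K) : Fin 2 → PowerSeries K :=
  ![PowerSeries.C (-a ^ 2) * PowerSeries.X, PowerSeries.X]

/-- This substitution is legitimate (the substituted series have no constant term). -/
theorem hasSubst_specialization {K : Type*} [Field K] (a : K) :
    MvPowerSeries.HasSubst (specialization a) := by
  apply MvPowerSeries.hasSubst_of_constantCoeff_zero
  intro s
  fin_cases s
  · change PowerSeries.constantCoeff (PowerSeries.C (-a ^ 2) * PowerSeries.X) = 0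
    simp
  · change PowerSeries.constantCoeff (PowerSeries.X : PowerSeries K) = 0
    simp

/-- The one-variable series obtained by the specialization `x₁ ↦ -a² x`, `x₂ ↦ x`. -/
def specializedSeries {K : Type*} [Field K] (a q : K) (f : ℕ) : PowerSeries K :=
  MvPowerSeries.subst (specialization a) (quiverSeries q f)

/-- `y(x) = P(q x) / P(q⁻¹ x)`, where `P` is the specialized quiver generating series. -/
def pathSeries {K : Type*} [Field K] (a q : K) (f : ℕ) : PowerSeries K :=
  PowerSeries.rescale q (specializedSeries a q f) *
    (PowerSeries.rescale q⁻¹ (specializedSeries a q f))⁻¹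

/-- The coefficient field `ℚ((a))((q))`: Laurent series in `q` whose coefficients are Laurent
series in `a`. It contains `ℚ(a, q)`, and each of its elements has a unique expansion in powers
of `a` and `q`. -/
abbrev CoeffField : Type := LaurentSeries (LaurentSeries ℚ)

/-- The indeterminate `a`. -/
def aVar : CoeffField := HahnSeries.C (HahnSeries.single 1 1)

/-- The indeterminate `q`. -/
def qVar : CoeffField := HahnSeries.single 1 1

/-- The coefficient of `a ^ i * q ^ j`. -/
def coeffAQ (i j : ℤ) (z : CoeffField) : ℚ := (z.coeff j).coeff i

/-- The coefficient `n_{i,j,k}` of `a ^ i * q ^ j * x ^ k` in `y`. -/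
def pathCoeff (f : ℕ) (i j : ℤ) (k : ℕ) : ℚ :=
  coeffAQ i j (PowerSeries.coeff k (pathSeries aVar qVar f))

end

/-! ### Generalized Schröder paths -/

/-- The elementary steps of a path in the square lattice. -/
inductive SchroderStep where
  | horizontal
  | vertical
  | diagonal

namespace SchroderStep

/-- The displacement of a step. -/
def vec : SchroderStep → ℕ × ℕ
  | horizontal => (1, 0)
  | vertical => (0, 1)
  | diagonal => (1, 1)

/-- 1 for a diagonal step and 0 for the others. -/
def diagWeight : SchroderStep → ℕ
  | horizontal => 0
  | vertical => 0
  | diagonal => 1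

/-- The (signed) area between the line `y = x / f` and the step `s` issuing from `p`, i.e. the
integral of `t / f - (height of the step over t)` over the columns covered by the step:
`∫ t in x..x+1, (t / f - y)` for a horizontal step from `(x, y)`,
`∫ t in x..x+1, (t / f - (y + (t - x)))` for a diagonal one, nothing for a vertical one. -/
def area (f : ℕ) (p : ℕ × ℕ) : SchroderStep → ℚ
  | horizontal => (2 * p.1 + 1) / (2 * f) - p.2
  | vertical => 0
  | diagonal => (2 * p.1 + 1) / (2 * f) - p.2 - 1 / 2

end SchroderStep

/-- A lattice path is the list of its steps; it starts at a lattice point `p`. -/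
abbrev LatticePath : Type := List SchroderStep

namespace LatticePath

/-- The final point of the path that starts at `p`. -/
def endpoint : ℕ × ℕ → LatticePath → ℕ × ℕ
  | p, [] => p
  | p, s :: l => endpoint (p + s.vec) l

/-- The path that starts at `p` stays (weakly) below the line `y = x / f`: all of its lattice
points `(x, y)` satisfy `f * y ≤ x`, hence so do all points of its segments. -/
def IsBelow (f : ℕ) : ℕ × ℕ → LatticePath → Prop
  | p, [] => f * p.2 ≤ p.1
  | p, s :: l => f * p.2 ≤ p.1 ∧ IsBelow f (p + s.vec) l

/-- The number of diagonal steps. -/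
def numDiag (l : LatticePath) : ℕ := (l.map SchroderStep.diagWeight).sum

/-- The area between the line `y = x / f` and the path that starts at `p`. -/
def areaFrom (f : ℕ) : ℕ × ℕ → LatticePath → ℚ
  | _, [] => 0
  | p, s :: l => s.area f p + areaFrom f (p + s.vec) l

end LatticePath

/-- The generalized Schröder paths under the line `y = x / f` from `(0, 0)` to `(f k, k)` with
`i / 2` diagonal steps and such that the area between the line and the path is `j / 2`. -/
def schroderPaths (f : ℕ) (i j : ℤ) (k : ℕ) : Set LatticePath :=
  {l | LatticePath.IsBelow f (0, 0) l ∧ LatticePath.endpoint (0, 0) l = (f * k, k) ∧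
    (LatticePath.numDiag l : ℚ) = i / 2 ∧ LatticePath.areaFrom f (0, 0) l = j / 2}

/-!
Let `P(x)` be the specialized quiver series. By the `q`-binomial theorem its coefficients are
`c n = (-1) ^ n * q ^ (f * n ^ 2) * ∏ s < n, (a ^ 2 + q ^ (2 s + 1)) / (1 - q ^ (2 s + 2))`, so they
satisfy a recurrence of order one (`coeff_specializedSeries_succ`), which is a linear
`q`-difference equation for `P`. Put `E m = P(q ^ (2 m - 1) x) / P(q⁻¹ x)` (`levelSeries`); then
`E 0 = 1`, `E 1` is the path series `y`, and the `q`-difference equation reads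
`E (h + 1) = E h + a ^ 2 q ^ (f - 1 + 2 h) x E (h + f) + q ^ (f + 2 h) x E (h + f + 1)`
(`levelSeries_succ`).

On the combinatorial side, let `Z (n, k)` be the sum over the paths below the line from the origin
to `(n, k)` of `a ^ (2 D) q ^ (-B)`, where `D` is the number of diagonal steps and `B` is twice the
area under the path (`LatticePath.pathSum`). Removing the last step of a path yields a recurrence
for `Z` (`LatticePath.pathSum_succ_succ`). Unlike the area up to the line, `B` is an integer at
every endpoint, so no fractional powers of `q` occur. With `h = n - f k` the horizontal distance
from the line, the two recurrences agree, and so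
`q ^ (f k ^ 2 + 2 h k) Z (f k + h, k)` is the coefficient of `x ^ k` in `E (h + 1)`
(`pathSum_eq_coeff_levelSeries`). In particular no decomposition of paths at their returns to the
line is needed: the product `E (h + 1) = ∏ s ≤ h, y(q ^ (2 s) x)` that such a decomposition would
give is a telescoping product of values of `P`.

For `h = 0` this expresses the coefficients of `y` by paths, and twice the area between the path
and the line is `f k ^ 2 - B` (`LatticePath.two_mul_areaFrom`).
-/

/-! ### The specialized quiver series -/

section Series

variable {K : Type*} [Field K]

theorem qPoch_succ (x p : K) (n : ℕ) : qPoch x p (n + 1) = qPoch x p n * (1 - x * p ^ n) :=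
  Finset.prod_range_succ _ _

theorem qPoch_ne_zero {q : K} (hq : ∀ n : ℕ, n ≠ 0 → q ^ n ≠ 1) (n : ℕ) :
    qPoch (q ^ 2) (q ^ 2) n ≠ 0 := by
  refine Finset.prod_ne_zero_iff.2 fun j _ => sub_ne_zero.2 fun h => hq (2 * (j + 1)) (by omega) ?_
  rw [pow_mul, pow_succ', ← h]

/-- The part of the coefficient of `x ^ n` in the specialized quiver series that remains after
extracting `(-1) ^ n * q ^ (f * n ^ 2)`; it does not depend on `f`. By the `q`-binomial theorem it
is `∏ s < n, (a ^ 2 + q ^ (2 * s + 1)) / (1 - q ^ (2 * s + 2))`. -/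
noncomputable def binomialSum (a q : K) (n : ℕ) : K :=
  ∑ d ∈ Finset.HasAntidiagonal.antidiagonal n, a ^ (2 * d.1) * q ^ d.2 ^ 2 /
    (qPoch (q ^ 2) (q ^ 2) d.1 * qPoch (q ^ 2) (q ^ 2) d.2)

/-- The `q`-binomial theorem, as a recurrence of order one. -/
theorem binomialSum_succ (a : K) {q : K} (hq : ∀ n : ℕ, n ≠ 0 → q ^ n ≠ 1) (n : ℕ) :
    (1 - q ^ (2 * (n + 1))) * binomialSum a q (n + 1) =
      (a ^ 2 + q ^ (2 * n + 1)) * binomialSum a q n := by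
  have hP := qPoch_ne_zero hq
  set t : ℕ → ℕ → K := fun i j => a ^ (2 * i) * q ^ j ^ 2 /
    (qPoch (q ^ 2) (q ^ 2) i * qPoch (q ^ 2) (q ^ 2) j) with ht
  have h1 (i j : ℕ) : (1 - q ^ (2 * (i + 1))) * t (i + 1) j = a ^ 2 * t i j := by
    have := hP (i + 1)
    rw [qPoch_succ] at this
    simp only [ht, qPoch_succ]
    have hi := left_ne_zero_of_mul this
    have hi' := right_ne_zero_of_mul this
    have hj := hP j
    field_simp
    ring
  have h2 (i j : ℕ) : q ^ (2 * i) * (1 - q ^ (2 * (j + 1))) * t i (j + 1) =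
      q ^ (2 * (i + j) + 1) * t i j := by
    have := hP (j + 1)
    rw [qPoch_succ] at this
    simp only [ht, qPoch_succ]
    have hi := left_ne_zero_of_mul this
    have hi' := right_ne_zero_of_mul this
    have hj := hP i
    field_simp
    ring
  -- `1 - q ^ (2 * (i + j))` is split into a part that lowers `i` and a part that lowers `j`.
  have hsplit : (1 - q ^ (2 * (n + 1))) * binomialSum a q (n + 1) =
      ∑ d ∈ Finset.HasAntidiagonal.antidiagonal (n + 1), (1 - q ^ (2 * d.1)) * t d.1 d.2 +
        ∑ d ∈ Finset.HasAntidiagonal.antidiagonal (n + 1), q ^ (2 * d.1) * (1 - q ^ (2 * d.2)) * t d.1 d.2 := by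
    rw [binomialSum, Finset.mul_sum, ← Finset.sum_add_distrib]
    refine Finset.sum_congr rfl fun d hd => ?_
    rw [← Finset.HasAntidiagonal.mem_antidiagonal.1 hd]
    simp only [ht]
    ring
  rw [hsplit, Finset.Nat.sum_antidiagonal_succ, Finset.Nat.sum_antidiagonal_succ']
  simp only [h1, h2, mul_zero, pow_zero, sub_self, zero_mul, zero_add]
  rw [binomialSum, add_mul, Finset.mul_sum, Finset.mul_sum]
  congr 1
  refine Finset.sum_congr rfl fun d hd => ?_
  rw [Finset.HasAntidiagonal.mem_antidiagonal.1 hd]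

theorem coeff_specializedSeries (a q : K) (f n : ℕ) :
    PowerSeries.coeff n (specializedSeries a q f) =
      (-1) ^ n * q ^ (f * n ^ 2) * binomialSum a q n := by
  let e : ℕ × ℕ ≃ (Fin 2 →₀ ℕ) := (finTwoArrowEquiv ℕ).symm.trans Finsupp.equivFunOnFinite.symm
  have e0 (d : ℕ × ℕ) : e d 0 = d.1 := rfl
  have e1 (d : ℕ × ℕ) : e d 1 = d.2 := rfl
  have key (d : ℕ × ℕ) :
      MvPowerSeries.coeff (e d) (quiverSeries q f) •
        MvPowerSeries.coeff (Finsupp.single () n)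
          ((e d).prod fun s m => specialization a s ^ m) =
      if d.1 + d.2 = n then (-1) ^ n * q ^ (f * n ^ 2) * (a ^ (2 * d.1) * q ^ d.2 ^ 2 /
        (qPoch (q ^ 2) (q ^ 2) d.1 * qPoch (q ^ 2) (q ^ 2) d.2)) else 0 := by
    have hprod : ((e d).prod fun s m => specialization a s ^ m) =
        (PowerSeries.C ((-a ^ 2) ^ d.1) * PowerSeries.X ^ (d.1 + d.2) : PowerSeries K) := by
      rw [Finsupp.prod_fintype _ _ (fun s => pow_zero _), Fin.prod_univ_two, e0, e1]
      change (PowerSeries.C (-a ^ 2) * PowerSeries.X : PowerSeries K) ^ d.1 *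
        PowerSeries.X ^ d.2 = _
      rw [mul_pow, ← map_pow, pow_add, mul_assoc]
    rw [hprod]
    change _ • PowerSeries.coeff n _ = _
    rw [PowerSeries.coeff_C_mul, PowerSeries.coeff_X_pow]
    rcases eq_or_ne (d.1 + d.2) n with rfl | h
    · rw [if_pos rfl, if_pos rfl, mul_one]
      change ((-1) ^ (f * ∑ s, e d s) * (-q) ^ (∑ s, ∑ t, quiverMatrix f s t * e d s * e d t) /
        ∏ s, qPoch (q ^ 2) (q ^ 2) (e d s)) • _ = _
      simp only [Fin.sum_univ_two, Fin.prod_univ_two, e0, e1, quiverMatrix, Matrix.of_apply,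
        Matrix.cons_val_zero, Matrix.cons_val_one, smul_eq_mul]
      obtain ⟨i, j⟩ := d
      have hexp : f * i * i + f * i * j + (f * j * i + (f + 1) * j * j) =
          f * (i + j) ^ 2 + j ^ 2 := by ring
      have hsign : (-1 : K) ^ (f * (i + j)) * (-1) ^ (f * (i + j) ^ 2 + j ^ 2) * (-1) ^ i =
          (-1) ^ (i + j) := by
        rw [← pow_add, ← pow_add]
        apply neg_one_pow_congr
        simp only [Nat.even_add, Nat.even_mul, Nat.even_pow]
        tauto
      rw [hexp, neg_pow q, neg_pow (a ^ 2), ← hsign, pow_add q]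
      ring
    · rw [if_neg h, if_neg (Ne.symm h), mul_zero, smul_zero]
  rw [specializedSeries, PowerSeries.coeff, MvPowerSeries.coeff_subst (hasSubst_specialization a),
    ← finsum_comp_equiv e]
  simp only [key]
  rw [finsum_eq_sum_of_support_subset (s := Finset.HasAntidiagonal.antidiagonal n), binomialSum, Finset.mul_sum]
  · exact Finset.sum_congr rfl fun d hd => if_pos (Finset.HasAntidiagonal.mem_antidiagonal.1 hd)
  · intro d hd
    rw [Finset.mem_coe, Finset.HasAntidiagonal.mem_antidiagonal]
    by_contra h
    exact hd (if_neg h)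

theorem coeff_specializedSeries_succ (a : K) {q : K} (hq : ∀ n : ℕ, n ≠ 0 → q ^ n ≠ 1)
    (f n : ℕ) :
    (1 - q ^ (2 * (n + 1))) * PowerSeries.coeff (n + 1) (specializedSeries a q f) =
      -(q ^ (f * (2 * n + 1)) * (a ^ 2 + q ^ (2 * n + 1)) *
        PowerSeries.coeff n (specializedSeries a q f)) := by
  rw [coeff_specializedSeries, coeff_specializedSeries]
  linear_combination (-1) ^ (n + 1) * q ^ (f * (n + 1) ^ 2) * binomialSum_succ a hq n

theorem constantCoeff_specializedSeries (a q : K) (f : ℕ) :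
    PowerSeries.constantCoeff (specializedSeries a q f) = 1 := by
  rw [← PowerSeries.coeff_zero_eq_constantCoeff_apply, coeff_specializedSeries]
  simp [binomialSum, qPoch]

/-- The quotient `P(q ^ (2 m - 1) x) / P(q⁻¹ x)`, where `P` is the specialized quiver series. It
equals `∏ s < m, y(q ^ (2 s) x)` with `y` the path series. Its coefficients are, up to powers of
`q`, the weighted sums over the paths that end `m - 1` units to the right of the line. -/
noncomputable def levelSeries (a q : K) (f m : ℕ) : PowerSeries K :=
  PowerSeries.rescale (q⁻¹ * (q ^ 2) ^ m) (specializedSeries a q f) *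
    (PowerSeries.rescale q⁻¹ (specializedSeries a q f))⁻¹

theorem levelSeries_zero (a q : K) (f : ℕ) : levelSeries a q f 0 = 1 := by
  rw [levelSeries, pow_zero, mul_one]
  apply PowerSeries.mul_inv_cancel
  rw [← PowerSeries.coeff_zero_eq_constantCoeff_apply, PowerSeries.coeff_rescale,
    PowerSeries.coeff_zero_eq_constantCoeff_apply, constantCoeff_specializedSeries]
  simp

theorem levelSeries_one (a : K) {q : K} (hq0 : q ≠ 0) (f : ℕ) :
    levelSeries a q f 1 = pathSeries a q f := by
  rw [levelSeries, pathSeries, pow_one, pow_two, inv_mul_cancel_left₀ hq0]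

/-- The `q`-difference equation of the specialized quiver series, divided by `P(q⁻¹ x)`. The three
terms on the right correspond to the three possible last steps of a path. -/
theorem levelSeries_succ (a : K) {q : K} (hq0 : q ≠ 0) (hq : ∀ n : ℕ, n ≠ 0 → q ^ n ≠ 1)
    (f h : ℕ) :
    levelSeries a q f (h + 1) = levelSeries a q f h + PowerSeries.X *
      (PowerSeries.C (a ^ 2 * q⁻¹ * q ^ (f + 2 * h)) * levelSeries a q f (h + f) +
        PowerSeries.C (q ^ (f + 2 * h)) * levelSeries a q f (h + f + 1)) := by
  have key : PowerSeries.rescale (q⁻¹ * (q ^ 2) ^ (h + 1)) (specializedSeries a q f) =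
      PowerSeries.rescale (q⁻¹ * (q ^ 2) ^ h) (specializedSeries a q f) + PowerSeries.X *
      (PowerSeries.C (a ^ 2 * q⁻¹ * q ^ (f + 2 * h)) *
          PowerSeries.rescale (q⁻¹ * (q ^ 2) ^ (h + f)) (specializedSeries a q f) +
        PowerSeries.C (q ^ (f + 2 * h)) *
          PowerSeries.rescale (q⁻¹ * (q ^ 2) ^ (h + f + 1)) (specializedSeries a q f)) := by
    ext n
    rcases n with _ | n
    · rw [map_add, PowerSeries.coeff_zero_X_mul, PowerSeries.coeff_rescale,
        PowerSeries.coeff_rescale, pow_zero, pow_zero, add_zero]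
    · rw [map_add, PowerSeries.coeff_succ_X_mul, map_add, PowerSeries.coeff_C_mul,
        PowerSeries.coeff_C_mul]
      simp only [PowerSeries.coeff_rescale]
      have hc := coeff_specializedSeries_succ a hq f n
      have hexp (x y : ℕ) : (q⁻¹ * (q ^ 2) ^ x) ^ y = q⁻¹ ^ y * q ^ (2 * x * y) := by
        rw [mul_pow, ← pow_mul, ← pow_mul, mul_assoc]
      have hinv : q * q⁻¹ = 1 := mul_inv_cancel₀ hq0
      simp only [hexp]
      linear_combination (-q⁻¹ ^ (n + 1) * q ^ (2 * h * (n + 1))) * hc +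
        q ^ (2 * n + 2 * n * h + 2 * n * f + 2 * h + f) * q⁻¹ ^ n *
          PowerSeries.coeff n (specializedSeries a q f) * hinv
  unfold levelSeries
  rw [key]
  ring

end Series

/-! ### Lattice paths and their last steps -/

namespace SchroderStep

instance : Finite SchroderStep :=
  Finite.of_surjective ![horizontal, vertical, diagonal] fun s =>
    match s with
    | horizontal => ⟨0, rfl⟩
    | vertical => ⟨1, rfl⟩
    | diagonal => ⟨2, rfl⟩

/-- Twice the area between the `x`-axis and a step that starts at height `y`. -/
def twiceAreaUnder (y : ℕ) : SchroderStep → ℕ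
  | horizontal => 2 * y
  | vertical => 0
  | diagonal => 2 * y + 1

end SchroderStep

namespace LatticePath

/-- Twice the area between the `x`-axis and the path that starts at `p`. -/
def twiceAreaUnder : ℕ × ℕ → LatticePath → ℕ
  | _, [] => 0
  | p, s :: l => s.twiceAreaUnder p.2 + twiceAreaUnder (p + s.vec) l

theorem endpoint_concat (p : ℕ × ℕ) (l : LatticePath) (s : SchroderStep) :
    endpoint p (l ++ [s]) = endpoint p l + s.vec := by
  induction l generalizing p with
  | nil => rfl
  | cons t l ih => exact ih _

theorem isBelow_concat (f : ℕ) (p : ℕ × ℕ) (l : LatticePath) (s : SchroderStep) :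
    IsBelow f p (l ++ [s]) ↔
      IsBelow f p l ∧ f * (endpoint p (l ++ [s])).2 ≤ (endpoint p (l ++ [s])).1 := by
  induction l generalizing p with
  | nil => rfl
  | cons t l ih =>
    simp only [List.cons_append, IsBelow, endpoint, ih, and_assoc]

theorem IsBelow.endpoint_below {f : ℕ} {p : ℕ × ℕ} {l : LatticePath} (h : IsBelow f p l) :
    f * (endpoint p l).2 ≤ (endpoint p l).1 := by
  induction l generalizing p with
  | nil => exact h
  | cons t l ih => exact ih h.2

theorem numDiag_concat (l : LatticePath) (s : SchroderStep) :
    numDiag (l ++ [s]) = numDiag l + s.diagWeight := by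
  simp [numDiag]

theorem twiceAreaUnder_concat (p : ℕ × ℕ) (l : LatticePath) (s : SchroderStep) :
    twiceAreaUnder p (l ++ [s]) = twiceAreaUnder p l + s.twiceAreaUnder (endpoint p l).2 := by
  induction l generalizing p with
  | nil => simp [twiceAreaUnder, endpoint]
  | cons t l ih => simp only [List.cons_append, twiceAreaUnder, endpoint, ih, add_assoc]

theorem length_le (p : ℕ × ℕ) (l : LatticePath) :
    l.length ≤ (endpoint p l).1 + (endpoint p l).2 := by
  suffices l.length + (p.1 + p.2) ≤ (endpoint p l).1 + (endpoint p l).2 by omega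
  induction l generalizing p with
  | nil => simp [endpoint]
  | cons s l ih =>
    have := ih (p + s.vec)
    rw [endpoint, List.length_cons]
    cases s <;> simp only [SchroderStep.vec, Prod.fst_add, Prod.snd_add] at * <;> omega

/-- Twice the area between the path and the line is the difference of twice the area under the
line and twice the area under the path. -/
theorem two_mul_areaFrom {f : ℕ} (hf : f ≠ 0) (p : ℕ × ℕ) (l : LatticePath) :
    2 * areaFrom f p l =
      ((endpoint p l).1 ^ 2 - p.1 ^ 2 : ℚ) / f - twiceAreaUnder p l := by
  have hf' : (f : ℚ) ≠ 0 := Nat.cast_ne_zero.2 hf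
  induction l generalizing p with
  | nil => simp [areaFrom, endpoint, twiceAreaUnder]
  | cons s l ih =>
    rw [areaFrom, mul_add, ih, endpoint, twiceAreaUnder]
    cases s <;> simp only [SchroderStep.area, SchroderStep.vec, SchroderStep.twiceAreaUnder,
      Prod.fst_add, Nat.cast_add, Nat.cast_one, Nat.cast_zero, Nat.cast_mul,
      Nat.cast_ofNat] <;> field_simp <;> ring

/-- The paths from the origin to `p` that stay below the line `y = x / f`. -/
def pathsTo (f : ℕ) (p : ℕ × ℕ) : Set LatticePath :=
  {l | IsBelow f (0, 0) l ∧ endpoint (0, 0) l = p}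

theorem finite_pathsTo (f : ℕ) (p : ℕ × ℕ) : (pathsTo f p).Finite :=
  (List.finite_length_le SchroderStep (p.1 + p.2)).subset fun _ hl => hl.2 ▸ length_le (0, 0) _

theorem pathsTo_eq_empty {f : ℕ} {p : ℕ × ℕ} (h : p.1 < f * p.2) : pathsTo f p = ∅ :=
  Set.eq_empty_of_forall_notMem fun _ hl => h.not_ge (hl.2 ▸ hl.1.endpoint_below)

theorem nil_mem_pathsTo {f : ℕ} {p : ℕ × ℕ} : [] ∈ pathsTo f p ↔ p = (0, 0) := by
  simp [pathsTo, IsBelow, endpoint, eq_comm]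

theorem concat_mem_pathsTo {f : ℕ} {p : ℕ × ℕ} {l : LatticePath} {s : SchroderStep} :
    l ++ [s] ∈ pathsTo f p ↔
      f * p.2 ≤ p.1 ∧ IsBelow f (0, 0) l ∧ endpoint (0, 0) l + s.vec = p := by
  simp only [pathsTo, Set.mem_ofPred_eq, isBelow_concat, endpoint_concat]
  constructor
  · rintro ⟨⟨h1, h2⟩, rfl⟩
    exact ⟨h2, h1, rfl⟩
  · rintro ⟨h2, h1, rfl⟩
    exact ⟨⟨h1, h2⟩, rfl⟩

theorem pathsTo_zero (f : ℕ) : pathsTo f (0, 0) = {[]} := by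
  ext l
  rcases List.eq_nil_or_concat' l with rfl | ⟨l, s, rfl⟩
  · simp [nil_mem_pathsTo]
  · rw [concat_mem_pathsTo]
    cases s <;> simp [SchroderStep.vec, Prod.ext_iff]

theorem pathsTo_succ_zero (f n : ℕ) :
    pathsTo f (n + 1, 0) = (· ++ [SchroderStep.horizontal]) '' pathsTo f (n, 0) := by
  ext l
  rcases List.eq_nil_or_concat' l with rfl | ⟨l, s, rfl⟩
  · simp [nil_mem_pathsTo]
  · rw [concat_mem_pathsTo]
    cases s <;> simp [SchroderStep.vec, Prod.ext_iff, pathsTo]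

theorem pathsTo_succ_succ {f n k : ℕ} (h : f * (k + 1) ≤ n + 1) :
    pathsTo f (n + 1, k + 1) =
      (· ++ [SchroderStep.horizontal]) '' pathsTo f (n, k + 1) ∪
        ((· ++ [SchroderStep.vertical]) '' pathsTo f (n + 1, k) ∪
          (· ++ [SchroderStep.diagonal]) '' pathsTo f (n, k)) := by
  ext l
  rcases List.eq_nil_or_concat' l with rfl | ⟨l, s, rfl⟩
  · simp [nil_mem_pathsTo]
  · rw [concat_mem_pathsTo]
    cases s <;> simp [SchroderStep.vec, Prod.ext_iff, pathsTo, h]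

/-! ### The weighted sum over paths with a given endpoint -/

section PathSum

variable {K : Type*} [Field K]

/-- The weight `a ^ (2 D) q ^ (-B)` of a path from the origin with `D` diagonal steps and twice the
area `B` below it. The area up to the line would give fractional exponents at endpoints off the
line. -/
noncomputable def weight (a q : K) (l : LatticePath) : K :=
  a ^ (2 * numDiag l) * q⁻¹ ^ twiceAreaUnder (0, 0) l

/-- The sum of the weights of the paths below the line `y = x / f` from the origin to `p`. -/
noncomputable def pathSum (a q : K) (f : ℕ) (p : ℕ × ℕ) : K :=
  ∑ᶠ l ∈ pathsTo f p, weight a q l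

theorem sum_weight_concat (a q : K) (f : ℕ) (p : ℕ × ℕ) (s : SchroderStep) :
    ∑ᶠ l ∈ (· ++ [s]) '' pathsTo f p, weight a q l =
      a ^ (2 * s.diagWeight) * q⁻¹ ^ s.twiceAreaUnder p.2 * pathSum a q f p := by
  rw [finsum_mem_image (List.append_left_injective [s]).injOn, pathSum, mul_finsum_mem]
  refine finsum_mem_congr rfl fun l hl => ?_
  rw [weight, weight, numDiag_concat, twiceAreaUnder_concat, hl.2]
  ring

theorem pathSum_eq_zero (a q : K) {f : ℕ} {p : ℕ × ℕ} (h : p.1 < f * p.2) :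
    pathSum a q f p = 0 := by
  rw [pathSum, pathsTo_eq_empty h, finsum_mem_empty]

theorem pathSum_zero (a q : K) (f : ℕ) : pathSum a q f (0, 0) = 1 := by
  rw [pathSum, pathsTo_zero, finsum_mem_singleton]
  simp [weight, numDiag, twiceAreaUnder]

theorem pathSum_succ_zero (a q : K) (f n : ℕ) :
    pathSum a q f (n + 1, 0) = pathSum a q f (n, 0) := by
  rw [pathSum, pathsTo_succ_zero, sum_weight_concat]
  simp [SchroderStep.diagWeight, SchroderStep.twiceAreaUnder]

theorem pathSum_succ_succ (a q : K) {f n k : ℕ} (h : f * (k + 1) ≤ n + 1) :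
    pathSum a q f (n + 1, k + 1) =
      q⁻¹ ^ (2 * (k + 1)) * pathSum a q f (n, k + 1) + (pathSum a q f (n + 1, k) +
        a ^ 2 * q⁻¹ ^ (2 * k + 1) * pathSum a q f (n, k)) := by
  have hdisj {s t : SchroderStep} (hst : s ≠ t) (A B : Set LatticePath) :
      Disjoint ((· ++ [s]) '' A) ((· ++ [t]) '' B) := by
    rw [Set.disjoint_left]
    rintro _ ⟨l, _, rfl⟩ ⟨l', _, h⟩
    exact hst (List.append_inj' h rfl |>.2 |> List.singleton_inj.1).symm
  have hfin (s : SchroderStep) (p : ℕ × ℕ) : ((· ++ [s]) '' pathsTo f p).Finite :=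
    (finite_pathsTo f p).image _
  rw [pathSum, pathsTo_succ_succ h,
    finsum_mem_union ((hdisj (by simp) _ _).union_right (hdisj (by simp) _ _)) (hfin _ _)
      ((hfin _ _).union (hfin _ _)),
    finsum_mem_union (hdisj (by simp) _ _) (hfin _ _) (hfin _ _), sum_weight_concat,
    sum_weight_concat, sum_weight_concat]
  simp [SchroderStep.diagWeight, SchroderStep.twiceAreaUnder]

end PathSum

end LatticePath

/-! ### Comparison of the two recurrences -/

open LatticePath

section Comparison

variable {K : Type*} [Field K]

theorem coeff_zero_levelSeries (a : K) {q : K} (hq0 : q ≠ 0) (hq : ∀ n : ℕ, n ≠ 0 → q ^ n ≠ 1)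
    (f h : ℕ) : PowerSeries.coeff 0 (levelSeries a q f h) = 1 := by
  induction h with
  | zero => simp [levelSeries_zero]
  | succ h ih =>
    rw [levelSeries_succ a hq0 hq, map_add, PowerSeries.coeff_zero_X_mul, ih, add_zero]

/-- The level series generate the weighted path sums. Both sides satisfy the same recurrence, the
right-hand side because of the `q`-difference equation and the left-hand side by removing the last
step of a path. -/
theorem pathSum_eq_coeff_levelSeries (a : K) {q : K} (hq0 : q ≠ 0)
    (hq : ∀ n : ℕ, n ≠ 0 → q ^ n ≠ 1) {f : ℕ} (hf : f ≠ 0) (k h : ℕ) :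
    q ^ (f * k ^ 2 + 2 * h * k) * pathSum a q f (f * k + h, k) =
      PowerSeries.coeff k (levelSeries a q f (h + 1)) := by
  obtain ⟨g, rfl⟩ := Nat.exists_eq_succ_of_ne_zero hf
  rw [Nat.succ_eq_add_one]
  induction k generalizing h with
  | zero =>
    have (n : ℕ) : pathSum a q (g + 1) (n, 0) = 1 := by
      induction n with
      | zero => exact pathSum_zero a q _
      | succ n ih => rw [pathSum_succ_zero, ih]
    rw [coeff_zero_levelSeries a hq0 hq, this]
    simp
  | succ k ihk =>
    have hpow (x y : ℕ) : q ^ (x + y) * q⁻¹ ^ y = q ^ x := by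
      rw [pow_add, mul_assoc, ← mul_pow, mul_inv_cancel₀ hq0, one_pow, mul_one]
    have hstep (h : ℕ) (hleft : q ^ ((g + 1) * (k + 1) ^ 2 + 2 * h * (k + 1)) *
        (q⁻¹ ^ (2 * (k + 1)) * pathSum a q (g + 1) ((g + 1) * k + (h + g), k + 1)) =
          PowerSeries.coeff (k + 1) (levelSeries a q (g + 1) h)) :
        q ^ ((g + 1) * (k + 1) ^ 2 + 2 * h * (k + 1)) *
          pathSum a q (g + 1) ((g + 1) * (k + 1) + h, k + 1) =
            PowerSeries.coeff (k + 1) (levelSeries a q (g + 1) (h + 1)) := by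
      have e : (g + 1) * (k + 1) + h = (g + 1) * k + (h + g) + 1 := by ring
      rw [levelSeries_succ a hq0 hq, map_add, PowerSeries.coeff_succ_X_mul, map_add,
        PowerSeries.coeff_C_mul, PowerSeries.coeff_C_mul, ← hleft, e,
        pathSum_succ_succ a q (by rw [← e]; omega), ← add_assoc h g 1, ← ihk, ← ihk]
      have e' : (g + 1) * k + (h + g + 1) = (g + 1) * k + (h + g) + 1 := rfl
      rw [e']
      linear_combination a ^ 2 * q⁻¹ * pathSum a q (g + 1) ((g + 1) * k + (h + g), k) *
        hpow (g + 1 + 2 * h + (g + 1) * k ^ 2 + 2 * (h + g) * k) (2 * k)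
    induction h with
    | zero =>
      -- At level zero no horizontal step can come last, and `levelSeries a q f 0 = 1` has no
      -- positive coefficients.
      apply hstep
      rw [pathSum_eq_zero a q (by simp only [mul_add, add_mul]; omega), levelSeries_zero,
        PowerSeries.coeff_one, if_neg k.succ_ne_zero, mul_zero,
        mul_zero, mul_zero]
    | succ h ih =>
      apply hstep
      have e : (g + 1) * (k + 1) ^ 2 + 2 * (h + 1) * (k + 1) =
        (g + 1) * (k + 1) ^ 2 + 2 * h * (k + 1) + 2 * (k + 1) := by ring
      have e' : (g + 1) * k + (h + 1 + g) = (g + 1) * (k + 1) + h := by ring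
      rw [e, ← mul_assoc, hpow, e', ih]

/-- The coefficients of the path series as generating functions of paths by number of diagonal
steps and area. -/
theorem coeff_pathSeries (a : K) {q : K} (hq0 : q ≠ 0) (hq : ∀ n : ℕ, n ≠ 0 → q ^ n ≠ 1) {f : ℕ}
    (hf : f ≠ 0) (k : ℕ) :
    PowerSeries.coeff k (pathSeries a q f) = ∑ l ∈ (finite_pathsTo f (f * k, k)).toFinset,
      a ^ (2 * numDiag l) * q ^ ((f * k ^ 2 : ℕ) - (twiceAreaUnder (0, 0) l : ℤ)) := by
  rw [← levelSeries_one a hq0, ← pathSum_eq_coeff_levelSeries a hq0 hq hf k 0, add_zero, pathSum,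
    finsum_mem_eq_finite_toFinset_sum _ (finite_pathsTo f (f * k, k)), Finset.mul_sum]
  refine Finset.sum_congr rfl fun l _ => ?_
  rw [zpow_sub₀ hq0, zpow_natCast, zpow_natCast, weight, mul_zero, zero_mul, add_zero, inv_pow]
  ring

end Comparison

/-! ### Coefficients of the path series -/

theorem qVar_zpow (n : ℤ) : qVar ^ n = HahnSeries.single n 1 :=
  (RatFunc.single_zpow n).symm

theorem qVar_ne_zero : qVar ≠ 0 := HahnSeries.single_ne_zero one_ne_zero

theorem qVar_pow_ne_one (n : ℕ) (hn : n ≠ 0) : qVar ^ n ≠ 1 := by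
  rw [qVar, HahnSeries.single_pow]
  intro h
  have := congrArg (fun z => HahnSeries.coeff z 0) h
  simp [HahnSeries.coeff_single] at this
  exact hn (by exact_mod_cast this.symm)

open Classical in
theorem coeffAQ_monomial (i j : ℤ) (m : ℕ) (n : ℤ) :
    coeffAQ i j (aVar ^ m * qVar ^ n) = if (m : ℤ) = i ∧ n = j then 1 else 0 := by
  rw [qVar_zpow, aVar, ← map_pow, HahnSeries.C_mul_eq_smul, HahnSeries.single_pow, coeffAQ,
    HahnSeries.coeff_smul, HahnSeries.coeff_single]
  by_cases hj : j = n <;> by_cases hi : i = m <;>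
    simp [hi, hj, eq_comm]

theorem coeffAQ_sum {ι : Type*} (i j : ℤ) (s : Finset ι) (z : ι → CoeffField) :
    coeffAQ i j (∑ l ∈ s, z l) = ∑ l ∈ s, coeffAQ i j (z l) := by
  simp [coeffAQ]

/-- The Schröder paths in terms of integral statistics: the triangle between the line and the
`x`-axis has twice the area `f * k ^ 2`. -/
theorem schroderPaths_eq {f : ℕ} (hf : f ≠ 0) (i j : ℤ) (k : ℕ) :
    schroderPaths f i j k = {l ∈ pathsTo f (f * k, k) |
      ((2 * numDiag l : ℕ) : ℤ) = i ∧ (f * k ^ 2 : ℕ) - (twiceAreaUnder (0, 0) l : ℤ) = j} := by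
  have hf' : (f : ℚ) ≠ 0 := Nat.cast_ne_zero.2 hf
  ext l
  simp only [schroderPaths, pathsTo, Set.mem_ofPred_eq, and_assoc]
  refine and_congr_right fun _ => and_congr_right fun he => and_congr ?_ ?_
  · rw [← @Int.cast_inj ℚ, eq_div_iff two_ne_zero, mul_comm]
    push_cast
    rfl
  · have harea := two_mul_areaFrom hf (0, 0) l
    rw [he] at harea
    have : (((f * k : ℕ) : ℚ) ^ 2 - ((0 : ℕ) : ℚ) ^ 2) / f = f * k ^ 2 := by
      push_cast
      field_simp
      ring
    rw [this] at harea
    rw [← @Int.cast_inj ℚ, eq_div_iff two_ne_zero, mul_comm, harea]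
    push_cast
    rfl

theorem mainTheorem4 (f : ℕ) (hf : 1 ≤ f) (i j : ℤ) (k : ℕ) :
    (schroderPaths f i j k).Finite ∧
      pathCoeff f i j k = ((schroderPaths f i j k).ncard : ℚ) := by
  classical
  have hf0 : f ≠ 0 := Nat.one_le_iff_ne_zero.1 hf
  have hfin := finite_pathsTo f (f * k, k)
  rw [schroderPaths_eq hf0]
  refine ⟨hfin.subset fun _ hl => hl.1, ?_⟩
  have hset : {l ∈ pathsTo f (f * k, k) | ((2 * numDiag l : ℕ) : ℤ) = i ∧
      (f * k ^ 2 : ℕ) - (twiceAreaUnder (0, 0) l : ℤ) = j} =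
      (hfin.toFinset.filter fun l => ((2 * numDiag l : ℕ) : ℤ) = i ∧
        (f * k ^ 2 : ℕ) - (twiceAreaUnder (0, 0) l : ℤ) = j : Finset LatticePath) := by
    ext l
    simp
  rw [pathCoeff, coeff_pathSeries aVar qVar_ne_zero qVar_pow_ne_one hf0, coeffAQ_sum, hset, Set.ncard_coe_finset]
  simp only [coeffAQ_monomial]
  rw [Finset.sum_boole]
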